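/- For a family $\mathcal F$ of subsets of $[n]=\{1,\dots,n\}$ and a finite poset $P$, a subfamily $\mathcal G\subseteq\mathcal F$ is a copy of $P$ if there is a bijection $\phi:P\to\mathcal G$ such that $x\le_P y$ implies $\phi(x)\subseteq\phi(y)$. Let $c(P,\mathcal F)$ be the number of copies of $P$ in $\mathcal F$; for a set $\mathcal P$ of finite posets, $\mathcal F$ is called $\mathcal P$-free if it contains no copy of any member of $\mathcal P$, and $$La(n,\mathcal P,Q)=\max\{c(Q,\mathcal F):\mathcal F\subseteq 2^{[n]},\ \mathcal F\text{ is }\mathcal P\text{-free}\}.$$ For $r\ge 1$ let $\wedge_r$ be the poset on $r+1$ elements $a,b_1,\dots,b_r$ whose only strict relations are $b_i<a$ $(1\le i\le r)$, and let $\vee_r$ be its dual. Theorem. Let $k,l,s$ be positive integers with $s\le k-1$, and suppose that (i) $s=k-1$, or (ii) $k\le 5$ and $l\le 5$. Then $$La(n,\{\wedge_k,\vee_l\},\wedge_s)=\left(\binom{k-1}{s}\frac{l-1}{k+l-2}+o(1)\right)\binom{n}{\lfloor n/2\rfloor}\qquad(n\to\infty),$$ where $k,l,s$ are fixed and the $o(1)$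 term may depend on them. -/

import Mathlib

open Filter Topology

namespace ForbiddenSubposet

/-- The underlying set of the poset `∧_r`: elements `b_1, …, b_r` (written `some i`) and one
further element `a` (written `none`). -/
def Wedge (r : ℕ) : Type := Option (Fin r)

/-- The order of `∧_r`: `b_i < a` for every `i`, and there are no other strict relations. -/
instance (r : ℕ) : PartialOrder (Wedge r) where
  le x y := x = y ∨ y = none
  le_refl x := Or.inl rfl
  le_trans x y z hxy hyz := by
    rcases hyz with rfl | rfl
    · exact hxy
    · exact Or.inr rfl
  le_antisymm x y hxy hyx := by
    rcases hxy with rfl | rfl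
    · rfl
    · rcases hyx with h | h
      · exact h.symm
      · exact h

instance (r : ℕ) : Fintype (Wedge r) := inferInstanceAs (Fintype (Option (Fin r)))

/-- The finite poset `∧_r`. -/
def wedge (r : ℕ) : FinPartOrd.{0} := FinPartOrd.of (Wedge r)

/-- The finite poset `∨_r`, the order dual of `∧_r`. -/
def vee (r : ℕ) : FinPartOrd.{0} := FinPartOrd.of (Wedge r)ᵒᵈ

/-- The family `G` of subsets of `[n]` is a (weak) copy of the poset `P`: there is a bijection
`φ` from `P` onto `G` such that `x ≤ y` in `P` implies `φ x ⊆ φ y`. -/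
def IsCopy {n : ℕ} (P : FinPartOrd.{0}) (G : Finset (Finset (Fin n))) : Prop :=
  ∃ φ : P ≃ {A : Finset (Fin n) // A ∈ G},
    ∀ x y : P, x ≤ y → (φ x : Finset (Fin n)) ⊆ (φ y : Finset (Fin n))

/-- The family `F` is `Ps`-free: no subfamily of `F` is a copy of a member of `Ps`. -/
def IsFree {n : ℕ} (Ps : Set FinPartOrd.{0}) (F : Finset (Finset (Fin n))) : Prop :=
  ∀ P ∈ Ps, ∀ G ⊆ F, ¬ IsCopy P G

open Classical in
/-- `c(Q, F)`: the number of subfamilies of `F` that are copies of `Q`. -/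
noncomputable def numCopies {n : ℕ} (Q : FinPartOrd.{0}) (F : Finset (Finset (Fin n))) : ℕ :=
  (F.powerset.filter fun G => IsCopy Q G).card

open Classical in
/-- `La(n, Ps, Q)`: the maximum of `c(Q, F)` over all `Ps`-free families `F` of subsets
of `[n]`. -/
noncomputable def La (n : ℕ) (Ps : Set FinPartOrd.{0}) (Q : FinPartOrd.{0}) : ℕ :=
  (Finset.univ.filter fun F : Finset (Finset (Fin n)) => IsFree Ps F).sup fun F => numCopies Q F

end ForbiddenSubposet

namespace ForbiddenSubposet

open Finset

/-! Put K = k - 1 and L = l - 1. Freeness means that every member of `F` has at most K members of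
`F` properly below it and at most L properly above it. A copy of `∧_s` has a unique apex, so the
number of copies is the sum of C(i, s) over the lower degrees i.

Upper bound. A family whose comparability degrees are bounded by a constant has at most (1 + o(1))
C(n, n/2) members, because a random maximal chain rarely meets two comparable members
(`card_mul_card_le_of_degree_le`). It therefore suffices to find such a family H for which the
number of copies is at most C(K, s) L/(K + L) |H|. If s = K, only members of full lower degree
count; they are maximal, and counting comparable pairs from both ends works with H = F. Otherwise
C(i, s) ≤ C(K, s) i/K reduces the problem to counting comparable pairs. Members with many neighbours
on both sides may push that count above KL|F|/(K + L). Each such x, with b ⊂ x ⊂ a in F, is paid for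
by its complement b ∪ (a \ x) in the interval [b, a]. For K, L ≤ 4 these complements lie outside F,
and H is F together with them.

Lower bound. Choose t disjoint blocks of size K - 1 + L and classify a set by the first block that
it meets in K - 1 elements (bottom) or K elements (top). The tops of one level and the bottoms of
the level beneath form a biregular graph with degrees K and L. Hence tops make up almost L/(K + L)
of all subsets of the blocks when t is large, and the same proportion appears asymptotically in the
middle level. -/

/-- The members of `F` that are proper subsets of `A`. -/
def below {α : Type*} [DecidableEq α] (F : Finset (Finset α)) (A : Finset α) :
    Finset (Finset α) := F.filter (· ⊂ A)

/-- The members of `F` that are proper supersets of `A`. -/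
def above {α : Type*} [DecidableEq α] (F : Finset (Finset α)) (A : Finset α) :
    Finset (Finset α) := F.filter (A ⊂ ·)

/-! ### Comparability degrees -/

section Degrees
variable {α : Type*} [DecidableEq α] {F : Finset (Finset α)} {A B : Finset α}

lemma mem_below : B ∈ below F A ↔ B ∈ F ∧ B ⊂ A := mem_filter

lemma mem_above : B ∈ above F A ↔ B ∈ F ∧ A ⊂ B := mem_filter

lemma below_mono (h : A ⊆ B) : below F A ⊆ below F B := fun _ hC =>
  mem_below.2 ⟨(mem_below.1 hC).1, (mem_below.1 hC).2.trans_subset h⟩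

lemma above_anti (h : A ⊆ B) : above F B ⊆ above F A := fun _ hC =>
  mem_above.2 ⟨(mem_above.1 hC).1, h.trans_ssubset (mem_above.1 hC).2⟩

lemma sum_card_above_eq_sum_card_below (F : Finset (Finset α)) :
    ∑ A ∈ F, #(above F A) = ∑ A ∈ F, #(below F A) := by
  simp only [card_eq_sum_ones]
  exact sum_comm' fun A B => by simp only [mem_above, mem_below]; tauto

end Degrees

/-- Serves `∧_s` and `∨_s` at once, with R the inclusion or its reverse. -/
lemma exists_option_equiv_iff {β : Type*} [DecidableEq β] (R : β → β → Prop) (s : ℕ)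
    (G : Finset β) :
    (∃ φ : Option (Fin s) ≃ {x // x ∈ G}, ∀ i, R (φ (some i)).1 (φ none).1) ↔
      ∃ a S, a ∉ S ∧ G = insert a S ∧ #S = s ∧ ∀ b ∈ S, R b a := by
  constructor
  · rintro ⟨φ, hφ⟩
    have hinj : Function.Injective fun i : Fin s => (φ (some i)).1 := fun i j hij =>
      Option.some_injective _ (φ.injective (Subtype.ext hij))
    refine ⟨(φ none).1, univ.image fun i => (φ (some i)).1, ?_, ?_, ?_, ?_⟩
    · simp only [mem_image, mem_univ, true_and, not_exists]
      intro i hi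
      simpa using φ.injective (Subtype.ext hi)
    · ext x
      constructor
      · intro hx
        rcases h : φ.symm ⟨x, hx⟩ with _ | i
        · have : φ none = ⟨x, hx⟩ := by rw [← h, Equiv.apply_symm_apply]
          simp [this]
        · have : φ (some i) = ⟨x, hx⟩ := by rw [← h, Equiv.apply_symm_apply]
          exact mem_insert_of_mem (mem_image.2 ⟨i, mem_univ _, by rw [this]⟩)
      · intro hx
        rcases mem_insert.1 hx with rfl | hx
        · exact (φ none).2
        · obtain ⟨i, -, rfl⟩ := mem_image.1 hx
          exact (φ (some i)).2
    · rw [card_image_of_injective _ hinj, card_univ, Fintype.card_fin]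
    · intro b hb
      obtain ⟨i, -, rfl⟩ := mem_image.1 hb
      exact hφ i
  · rintro ⟨a, S, haS, rfl, rfl, hR⟩
    let e : Fin #S ≃ {x // x ∈ S} := S.equivFin.symm
    let f : Option (Fin #S) → {x // x ∈ insert a S} := fun o =>
      o.elim ⟨a, mem_insert_self _ _⟩ fun i => ⟨(e i).1, mem_insert_of_mem (e i).2⟩
    have hf : Function.Bijective f := by
      constructor
      · rintro (_ | i) (_ | j) hij
        · rfl
        · exact absurd (congrArg Subtype.val hij) fun h : a = (e j).1 => haS (h ▸ (e j).2)
        · exact absurd (congrArg Subtype.val hij) fun h : (e i).1 = a => haS (h ▸ (e i).2)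
        · have h : (f (some i)).1 = (f (some j)).1 := by rw [hij]
          exact congrArg some (e.injective (Subtype.ext h))
      · rintro ⟨x, hx⟩
        by_cases hxS : x ∈ S
        · exact ⟨some (e.symm ⟨x, hxS⟩), Subtype.ext (by simp [f])⟩
        · exact ⟨none, Subtype.ext ((mem_insert.1 hx).resolve_right hxS).symm⟩
    exact ⟨Equiv.ofBijective f hf, fun i => hR _ (e i).2⟩

/-! ### Freeness and copy counts in terms of degrees -/

section Copies
variable {n : ℕ} {F G : Finset (Finset (Fin n))}

lemma isCopy_wedge_iff {s : ℕ} :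
    IsCopy (wedge s) G ↔ ∃ A S, #S = s ∧ (∀ B ∈ S, B ⊂ A) ∧ G = insert A S := by
  have h : IsCopy (wedge s) G ↔
      ∃ φ : Option (Fin s) ≃ {x // x ∈ G}, ∀ i, (φ (some i)).1 ⊆ (φ none).1 := by
    constructor
    · rintro ⟨φ, hφ⟩
      exact ⟨φ, fun i => hφ (some i : Option (Fin s)) (none : Option (Fin s)) (Or.inr rfl)⟩
    · rintro ⟨φ, hφ⟩
      refine ⟨φ, fun x y hxy => ?_⟩
      rcases hxy with rfl | rfl
      · exact Subset.rfl
      · rcases x with _ | i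
        · exact Subset.rfl
        · exact hφ i
  refine h.trans ((exists_option_equiv_iff (fun B A => B ⊆ A) s G).trans ?_)
  constructor
  · rintro ⟨A, S, hA, hG, hS, hR⟩
    exact ⟨A, S, hS, fun B hB => (hR B hB).ssubset_of_ne fun h => hA (h ▸ hB), hG⟩
  · rintro ⟨A, S, hS, hR, hG⟩
    exact ⟨A, S, fun hA => (hR A hA).ne rfl, hG, hS, fun B hB => (hR B hB).subset⟩

lemma isCopy_vee_iff {s : ℕ} :
    IsCopy (vee s) G ↔ ∃ A S, #S = s ∧ (∀ B ∈ S, A ⊂ B) ∧ G = insert A S := by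
  have h : IsCopy (vee s) G ↔
      ∃ φ : Option (Fin s) ≃ {x // x ∈ G}, ∀ i, (φ none).1 ⊆ (φ (some i)).1 := by
    constructor
    · rintro ⟨φ, hφ⟩
      exact ⟨φ, fun i => hφ (none : Option (Fin s)) (some i : Option (Fin s)) (Or.inr rfl)⟩
    · rintro ⟨φ, hφ⟩
      refine ⟨φ, fun x y hxy => ?_⟩
      rcases hxy with rfl | rfl
      · exact Subset.rfl
      · rcases y with _ | i
        · exact Subset.rfl
        · exact hφ i
  refine h.trans ((exists_option_equiv_iff (fun B A => A ⊆ B) s G).trans ?_)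
  constructor
  · rintro ⟨A, S, hA, hG, hS, hR⟩
    exact ⟨A, S, hS, fun B hB => (hR B hB).ssubset_of_ne fun h => hA (h ▸ hB), hG⟩
  · rintro ⟨A, S, hS, hR, hG⟩
    exact ⟨A, S, fun hA => (hR A hA).ne rfl, hG, hS, fun B hB => (hR B hB).subset⟩

lemma isFree_wedge_vee_iff {k l : ℕ} :
    IsFree {wedge k, vee l} F ↔ ∀ A ∈ F, #(below F A) < k ∧ #(above F A) < l := by
  simp only [IsFree, Set.mem_insert_iff, Set.mem_singleton_iff, forall_eq_or_imp, forall_eq,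
    isCopy_wedge_iff, isCopy_vee_iff]
  constructor
  · rintro ⟨h₁, h₂⟩ A hA
    constructor <;> by_contra! hc
    · obtain ⟨S, hS, hcard⟩ := exists_subset_card_eq hc
      refine h₁ (insert A S) (insert_subset hA fun B hB => (mem_below.1 (hS hB)).1)
        ⟨A, S, hcard, fun B hB => (mem_below.1 (hS hB)).2, rfl⟩
    · obtain ⟨S, hS, hcard⟩ := exists_subset_card_eq hc
      refine h₂ (insert A S) (insert_subset hA fun B hB => (mem_above.1 (hS hB)).1)
        ⟨A, S, hcard, fun B hB => (mem_above.1 (hS hB)).2, rfl⟩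
  · refine fun h => ⟨?_, ?_⟩
    · rintro _ hG ⟨A, S, rfl, hS, rfl⟩
      exact (h A (hG (mem_insert_self _ _))).1.not_ge
        (card_le_card fun B hB => mem_below.2 ⟨hG (mem_insert_of_mem hB), hS B hB⟩)
    · rintro _ hG ⟨A, S, rfl, hS, rfl⟩
      exact (h A (hG (mem_insert_self _ _))).2.not_ge
        (card_le_card fun B hB => mem_above.2 ⟨hG (mem_insert_of_mem hB), hS B hB⟩)

/-- A copy determines its apex: two different apexes would each lie properly below the other. -/
lemma numCopies_wedge (s : ℕ) (F : Finset (Finset (Fin n))) :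
    numCopies (wedge s) F = ∑ A ∈ F, (#(below F A)).choose s := by
  classical
  simp_rw [← card_powersetCard s (below F _)]
  rw [numCopies, ← card_sigma]
  symm
  refine card_bij (fun p _ => insert p.1 p.2) ?_ ?_ ?_
  · rintro ⟨A, S⟩ h
    simp only [mem_sigma, mem_powersetCard] at h
    rw [mem_filter, mem_powerset, isCopy_wedge_iff]
    exact ⟨insert_subset h.1 fun B hB => (mem_below.1 (h.2.1 hB)).1, A, S, h.2.2,
      fun B hB => (mem_below.1 (h.2.1 hB)).2, rfl⟩
  · rintro ⟨A, S⟩ h ⟨A', S'⟩ h' heq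
    simp only [mem_sigma, mem_powersetCard] at h h' heq
    have hlt : ∀ B ∈ S, B ⊂ A := fun B hB => (mem_below.1 (h.2.1 hB)).2
    have hlt' : ∀ B ∈ S', B ⊂ A' := fun B hB => (mem_below.1 (h'.2.1 hB)).2
    have hAA : A = A' := by
      by_contra hne
      have h1 : A ∈ S' := (mem_insert.1 (heq ▸ mem_insert_self A S)).resolve_left hne
      have h2 : A' ∈ S :=
        (mem_insert.1 (heq.symm ▸ mem_insert_self A' S')).resolve_left (Ne.symm hne)
      exact ((hlt' A h1).trans (hlt A' h2)).ne rfl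
    subst hAA
    have hS : S = S' := by
      rw [← erase_insert (fun hA => (hlt A hA).ne rfl : A ∉ S), heq,
        erase_insert (fun hA => (hlt' A hA).ne rfl : A ∉ S')]
    rw [hS]
  · intro G hG
    rw [mem_filter, mem_powerset, isCopy_wedge_iff] at hG
    obtain ⟨hGF, A, S, hS, hlt, rfl⟩ := hG
    refine ⟨⟨A, S⟩, ?_, rfl⟩
    simp only [mem_sigma, mem_powersetCard]
    exact ⟨hGF (mem_insert_self _ _), fun B hB =>
      mem_below.2 ⟨hGF (mem_insert_of_mem hB), hlt B hB⟩, hS⟩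

end Copies

/-! ### Size of families of bounded degree, by counting maximal chains -/

section Numberings
open Nat Numbering
variable {α : Type*} [Fintype α] [DecidableEq α]

lemma card_prefixed_inter_prefixed_le {A B : Finset α} (h : A ⊆ B) :
    #(prefixed A ∩ prefixed B) ≤ (#A)! * ((#B - #A)! * (Fintype.card α - #B)!) := by
  classical
  -- `T` is B \ A inside the complement of A. A numbering with prefix A splits into numberings of A
  -- and of its complement, and prefix B becomes prefix `T` of the second.
  let T : Finset ↥(Aᶜ) := univ.filter fun x => x.1 ∈ B
  have hT : #T = #B - #A := by
    rw [← card_sdiff_of_subset h, ← card_map (Function.Embedding.subtype _)]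
    congr 1
    ext x
    simp [T, and_comm]
  have hcard : Fintype.card ↥(Aᶜ) - #T = Fintype.card α - #B := by
    have h1 := card_le_card h
    have h2 := B.card_le_univ
    simp only [Fintype.card_coe, card_compl, hT]
    omega
  rw [← hT, ← hcard, ← card_prefixed T]
  have hA : (#A)! = #(univ : Finset (Numbering A)) := by
    rw [Finset.card_univ, Fintype.card_numbering, Fintype.card_coe]
  rw [hA, ← card_product]
  -- The `else` value is arbitrary and never used on the domain.
  refine card_le_card_of_injOn
    (fun f => if hf : f ∈ prefixed A then prefixedEquiv A ⟨f, hf⟩ else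
      (Fintype.equivFin _, Fintype.equivFin _)) ?_ ?_
  · intro f hf
    rw [mem_coe, mem_inter] at hf
    simp only [dif_pos hf.1]
    rw [mem_coe, mem_product]
    refine ⟨mem_univ _, mem_prefixed.2 fun x => ?_⟩
    have hB := mem_prefixed.1 hf.2 x.1
    have hA := (mem_prefixed.1 hf.1 x.1).not.1 (mem_compl.1 x.2)
    have : ((prefixedEquiv A ⟨f, hf.1⟩).2 x : ℕ) = f x.1 - #A := rfl
    rw [this, hT]
    have h1 := card_le_card h
    simp only [T, mem_filter, mem_univ, true_and, hB]
    omega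
  · intro f hf g hg hfg
    rw [mem_coe, mem_inter] at hf hg
    simp only [dif_pos hf.1, dif_pos hg.1] at hfg
    exact congrArg Subtype.val ((prefixedEquiv A).injective hfg)

lemma le_choose_of_pos_of_lt {m d : ℕ} (hd : 0 < d) (hdm : d < m) : m ≤ m.choose d := by
  obtain ⟨d, rfl⟩ := Nat.exists_eq_succ_of_ne_zero hd.ne'
  induction m with
  | zero => omega
  | succ m ih =>
    rcases Nat.lt_or_ge (d + 1) m with h | h
    · have := ih h
      rw [Nat.choose_succ_succ']
      have := Nat.choose_pos (show d ≤ m by omega)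
      simp only [Nat.succ_eq_add_one] at *
      omega
    · have : m = d + 1 := by omega
      subst this
      exact (Nat.choose_succ_self_right (d + 1)).ge

/-- Given prefix A, the chance of prefix B is 1/C(N - |A|, |B| - |A|); given prefix B, the chance of
prefix A is 1/C(|B|, |A|). Whichever of N - |A| and |B| is at least N/2 gives a chance of at most
2/N. Excluding the full set avoids the pair ∅, `univ`, for which both chances are 1. -/
lemma card_mul_card_prefixed_inter_le {A B : Finset α} (h : A ⊂ B) (hB : B ≠ univ) :
    Fintype.card α * #(prefixed A ∩ prefixed B) ≤ 2 * (#(prefixed A) + #(prefixed B)) := by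
  have hAB := card_lt_card h
  have hBn : #B < Fintype.card α := (card_lt_iff_ne_univ B).2 hB
  have hle := card_prefixed_inter_prefixed_le h.subset
  set N := Fintype.card α
  set I := #(prefixed A ∩ prefixed B)
  rcases Nat.le_total (2 * #A) N with hA | hA
  · have hc := le_choose_of_pos_of_lt (m := N - #A) (d := #B - #A) (by omega) (by omega)
    have hf := Nat.choose_mul_factorial_mul_factorial (n := N - #A) (k := #B - #A) (by omega)
    rw [show N - #A - (#B - #A) = N - #B by omega] at hf
    have h1 : (N - #A) * I ≤ #(prefixed A) := by
      rw [card_prefixed]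
      calc (N - #A) * I ≤ (N - #A).choose (#B - #A) *
            ((#A)! * ((#B - #A)! * (N - #B)!)) := Nat.mul_le_mul hc hle
        _ = (#A)! * (N - #A)! := by rw [← hf]; ring
    calc N * I ≤ 2 * (N - #A) * I := Nat.mul_le_mul_right _ (by omega)
      _ = 2 * ((N - #A) * I) := by ring
      _ ≤ _ := by omega
  · have hc := le_choose_of_pos_of_lt (m := #B) (d := #A) (by omega) (by omega)
    have hf := Nat.choose_mul_factorial_mul_factorial hAB.le
    have h1 : #B * I ≤ #(prefixed B) := by
      rw [card_prefixed]
      calc #B * I ≤ (#B).choose #A *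
            ((#A)! * ((#B - #A)! * (N - #B)!)) := Nat.mul_le_mul hc hle
        _ = (#B)! * (N - #B)! := by rw [← hf]; ring
    calc N * I ≤ 2 * #B * I := Nat.mul_le_mul_right _ (by omega)
      _ = 2 * (#B * I) := by ring
      _ ≤ _ := by omega

lemma sum_card_eq_sum_card_filter_mem {ι β : Type*} [Fintype β] [DecidableEq β] (H : Finset ι)
    (p : ι → Finset β) : ∑ a ∈ H, #(p a) = ∑ f, #(H.filter fun a => f ∈ p a) := by
  simp_rw [card_filter]
  rw [sum_comm]
  simp

/-- The members that are prefixes of `f` form a chain, and the smallest is paired with each of the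
others. -/
lemma card_filter_prefixed_le (H : Finset (Finset α)) (f : Numbering α) :
    #(H.filter fun A => f ∈ prefixed A) ≤
      1 + ∑ A ∈ H, #((above H A).filter fun B => f ∈ prefixed A ∩ prefixed B) := by
  set P := H.filter fun A => f ∈ prefixed A
  rcases P.eq_empty_or_nonempty with hP | hP
  · simp [hP]
  obtain ⟨A, hA, hmin⟩ := P.exists_min_image card hP
  have hA' := mem_filter.1 hA
  have hsub : P.erase A ⊆ (above H A).filter fun B => f ∈ prefixed A ∩ prefixed B := by
    intro B hB
    rw [mem_erase] at hB
    have hB' := mem_filter.1 hB.2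
    have : A ⊆ B := (mem_prefixed.1 hA'.2).subset_of_card_le_card (mem_prefixed.1 hB'.2)
      (hmin B hB.2)
    exact mem_filter.2 ⟨mem_above.2 ⟨hB'.1, this.ssubset_of_ne (Ne.symm hB.1)⟩,
      mem_inter.2 ⟨hA'.2, hB'.2⟩⟩
  have h1 := card_le_card hsub
  rw [card_erase_of_mem hA] at h1
  have h2 := single_le_sum (f := fun A => #((above H A).filter fun B =>
    f ∈ prefixed A ∩ prefixed B)) (fun _ _ => Nat.zero_le _) hA'.1
  omega

/-- A Lubell–Yamamoto–Meshalkin type bound for families of bounded comparability degree. -/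
lemma card_mul_card_le_of_degree_le {H : Finset (Finset α)} {D : ℕ} (huniv : univ ∉ H)
    (hD : ∀ A ∈ H, #(below H A) ≤ D ∧ #(above H A) ≤ D) :
    Fintype.card α * #H ≤
      Fintype.card α * (Fintype.card α).choose (Fintype.card α / 2) + 4 * D * #H := by
  set N := Fintype.card α with hN
  set S := ∑ A ∈ H, #(prefixed A) with hS
  set M := ∑ A ∈ H, ∑ B ∈ above H A, #(prefixed A ∩ prefixed B) with hM
  have hSM : S ≤ N ! + M := by
    have h1 : S = ∑ f : Numbering α, #(H.filter fun A => f ∈ prefixed A) := by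
      exact sum_card_eq_sum_card_filter_mem H prefixed
    have h2 : M = ∑ f : Numbering α,
        ∑ A ∈ H, #((above H A).filter fun B => f ∈ prefixed A ∩ prefixed B) := by
      rw [hM, sum_comm]
      refine sum_congr rfl fun A _ => ?_
      exact sum_card_eq_sum_card_filter_mem _ fun B => prefixed A ∩ prefixed B
    have h3 : N ! = ∑ _f : Numbering α, 1 := by
      rw [sum_const, Finset.card_univ, Fintype.card_numbering, smul_eq_mul, mul_one]
    rw [h1, h2, h3, ← sum_add_distrib]
    exact sum_le_sum fun f _ => card_filter_prefixed_le H f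
  have hMS : N * M ≤ 4 * D * S := by
    have h1 : ∑ A ∈ H, ∑ _B ∈ above H A, #(prefixed A) ≤ D * S := by
      rw [hS, mul_sum]
      refine sum_le_sum fun A hA => ?_
      rw [sum_const, smul_eq_mul]
      exact Nat.mul_le_mul_right _ (hD A hA).2
    have h2 : ∑ A ∈ H, ∑ B ∈ above H A, #(prefixed B) ≤ D * S := by
      have : ∑ A ∈ H, ∑ B ∈ above H A, #(prefixed B) =
          ∑ B ∈ H, ∑ _A ∈ below H B, #(prefixed B) :=
        sum_comm' fun A B => by simp only [mem_above, mem_below]; tauto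
      rw [this, hS, mul_sum]
      refine sum_le_sum fun A hA => ?_
      rw [sum_const, smul_eq_mul]
      exact Nat.mul_le_mul_right _ (hD A hA).1
    calc N * M = ∑ A ∈ H, ∑ B ∈ above H A, N * #(prefixed A ∩ prefixed B) := by
          simp_rw [hM, mul_sum]
      _ ≤ ∑ A ∈ H, ∑ B ∈ above H A, 2 * (#(prefixed A) + #(prefixed B)) :=
          sum_le_sum fun A _ => sum_le_sum fun B hB =>
            card_mul_card_prefixed_inter_le (mem_above.1 hB).2
              fun h => huniv (h ▸ (mem_above.1 hB).1)
      _ = 2 * (∑ A ∈ H, ∑ _B ∈ above H A, #(prefixed A)) +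
            2 * ∑ A ∈ H, ∑ B ∈ above H A, #(prefixed B) := by
          simp_rw [mul_sum, ← sum_add_distrib, mul_add]
      _ ≤ 4 * D * S := by nlinarith
  have hHS : #H * N ! ≤ N.choose (N / 2) * S := by
    rw [hS, mul_sum, ← smul_eq_mul, ← sum_const]
    refine sum_le_sum fun A _ => ?_
    rw [card_prefixed, ← Nat.choose_mul_factorial_mul_factorial A.card_le_univ, mul_assoc]
    exact Nat.mul_le_mul_right _ (Nat.choose_le_middle _ _)
  -- Here N - 4D = E + 1, and N·S ≤ N·N! + 4D·S is solved for S; if N ≤ 4D the claim is trivial.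
  rcases Nat.lt_or_ge (4 * D) N with hDN | hDN
  · obtain ⟨E, hE⟩ := Nat.exists_eq_add_of_lt hDN
    have h1 : (E + 1) * S ≤ N * N ! := by nlinarith
    have h2 : N ! * ((E + 1) * #H) ≤ N ! * (N * N.choose (N / 2)) := by
      calc N ! * ((E + 1) * #H) = (E + 1) * (#H * N !) := by ring
        _ ≤ (E + 1) * (N.choose (N / 2) * S) := Nat.mul_le_mul_left _ hHS
        _ = N.choose (N / 2) * ((E + 1) * S) := by ring
        _ ≤ N.choose (N / 2) * (N * N !) := Nat.mul_le_mul_left _ h1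
        _ = _ := by ring
    have h3 := Nat.le_of_mul_le_mul_left h2 (Nat.factorial_pos N)
    have h4 : N * #H = (E + 1) * #H + 4 * D * #H := by
      conv_lhs => rw [hE]
      ring
    omega
  · exact (Nat.mul_le_mul_right _ hDN).trans (Nat.le_add_left _ _)

end Numberings

/-- For i ≥ 1, C(i, s)/i = C(i - 1, s - 1)/s, which is nondecreasing in i. -/
lemma mul_choose_le_choose_mul {i K s : ℕ} (hs : 1 ≤ s) (hi : i ≤ K) :
    K * i.choose s ≤ K.choose s * i := by
  obtain ⟨s, rfl⟩ := Nat.exists_eq_add_of_le' hs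
  rcases i with _ | i
  · simp
  obtain ⟨K, rfl⟩ := Nat.exists_eq_add_of_le' (Nat.one_le_iff_ne_zero.2 (by omega : K ≠ 0))
  have h1 := Nat.add_one_mul_choose_eq i s
  have h2 := Nat.add_one_mul_choose_eq K s
  have h3 := Nat.choose_le_choose s (show i ≤ K by omega)
  refine Nat.le_of_mul_le_mul_right (c := s + 1) ?_ (Nat.succ_pos s)
  calc (K + 1) * (i + 1).choose (s + 1) * (s + 1)
      = (K + 1) * (i + 1) * i.choose s := by rw [mul_assoc, ← h1, mul_assoc]
    _ ≤ (K + 1) * (i + 1) * K.choose s := Nat.mul_le_mul_left _ h3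
    _ = (i + 1) * ((K + 1) * K.choose s) := by ring
    _ = _ := by rw [h2]; ring

/-! ### Upper bound: copies against the size of an enlarged family -/

section Bounds
variable {α : Type*} [DecidableEq α] {F : Finset (Finset α)} {K L : ℕ}

lemma below_ssubset_below {A B : Finset α} (hA : A ∈ F) (h : A ⊂ B) :
    #(below F A) < #(below F B) :=
  card_lt_card <| (ssubset_iff_of_subset (below_mono h.subset)).2
    ⟨A, mem_below.2 ⟨hA, h⟩, fun h' => (mem_below.1 h').2.ne rfl⟩

/-- Lower degrees strictly increase along inclusions, so the set X of members of lower degree K has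
nothing above it. Comparable pairs then number at least K|X| and at most L(|F| - |X|). -/
lemma sum_choose_below_top_le (hK : ∀ A ∈ F, #(below F A) ≤ K) (hL : ∀ A ∈ F, #(above F A) ≤ L) :
    (K + L) * ∑ A ∈ F, (#(below F A)).choose K ≤ L * #F := by
  set X := F.filter fun A => #(below F A) = K
  have hX : ∑ A ∈ F, (#(below F A)).choose K = #X := by
    rw [card_filter]
    refine sum_congr rfl fun A hA => ?_
    split_ifs with h
    · rw [h, Nat.choose_self]
    · exact Nat.choose_eq_zero_of_lt (lt_of_le_of_ne (hK A hA) h)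
  have hlow : K * #X ≤ ∑ A ∈ F, #(below F A) := by
    rw [mul_comm, ← smul_eq_mul, ← sum_const]
    calc ∑ _A ∈ X, K = ∑ A ∈ X, #(below F A) :=
          sum_congr rfl fun A hA => (mem_filter.1 hA).2.symm
      _ ≤ _ := sum_le_sum_of_subset (filter_subset _ _)
  have hupp : ∑ A ∈ F, #(above F A) + L * #X ≤ L * #F := by
    have : L * #X = ∑ A ∈ F, if #(below F A) = K then L else 0 := by
      rw [← sum_filter, sum_const, smul_eq_mul, mul_comm]
    rw [this, ← sum_add_distrib, mul_comm L, ← smul_eq_mul, ← sum_const]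
    refine sum_le_sum fun A hA => ?_
    split_ifs with h
    · have : above F A = ∅ := by
        by_contra hne
        obtain ⟨B, hB⟩ := nonempty_iff_ne_empty.2 hne
        rw [mem_above] at hB
        have h1 := below_ssubset_below hA hB.2
        have h2 := hK B hB.1
        omega
      simp [this]
    · simpa using hL A hA
  rw [sum_card_above_eq_sum_card_below] at hupp
  rw [hX]
  nlinarith

/-- The members of `F` whose degrees exceed the average allowed by the biregular bound. -/
def heavy (F : Finset (Finset α)) (K L : ℕ) : Finset (Finset α) :=
  F.filter fun x => K * L < #(below F x) * L + #(above F x) * K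

/-- The complements `b ∪ (a \ x)` of heavy members `x` in the intervals `[b, a]` spanned by
members `b ⊂ x ⊂ a` of `F`. -/
def complements (F : Finset (Finset α)) (K L : ℕ) : Finset (Finset α) :=
  (heavy F K L).biUnion fun x => (below F x ×ˢ above F x).image fun p => p.1 ∪ (p.2 \ x)

lemma mem_complements {y : Finset α} : y ∈ complements F K L ↔
    ∃ x ∈ heavy F K L, ∃ b ∈ below F x, ∃ a ∈ above F x, b ∪ (a \ x) = y := by
  simp only [complements, mem_biUnion, mem_image, mem_product, Prod.exists, and_assoc]
  constructor
  · rintro ⟨x, hx, b, a, hb, ha, rfl⟩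
    exact ⟨x, hx, b, hb, a, ha, rfl⟩
  · rintro ⟨x, hx, b, hb, a, ha, rfl⟩
    exact ⟨x, hx, b, a, hb, ha, rfl⟩

lemma ssubset_union_sdiff {a b x : Finset α} (hb : b ⊂ x) (ha : x ⊂ a) : b ⊂ b ∪ (a \ x) := by
  refine (ssubset_iff_of_subset subset_union_left).2 ?_
  obtain ⟨z, hz, hzx⟩ := exists_of_ssubset ha
  exact ⟨z, mem_union_right _ (mem_sdiff.2 ⟨hz, hzx⟩), fun h => hzx (hb.subset h)⟩

lemma union_sdiff_ssubset {a b x : Finset α} (hb : b ⊂ x) (ha : x ⊂ a) : b ∪ (a \ x) ⊂ a := by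
  refine (ssubset_iff_of_subset
    (union_subset (hb.subset.trans ha.subset) sdiff_subset)).2 ?_
  obtain ⟨z, hz, hzb⟩ := exists_of_ssubset hb
  exact ⟨z, ha.subset hz, by simp [hzb, hz]⟩

lemma union_sdiff_union_sdiff {a b x : Finset α} (hb : b ⊂ x) (ha : x ⊂ a) :
    b ∪ (a \ (b ∪ (a \ x))) = x := by
  ext z
  have h1 : z ∈ b → z ∈ x := fun h => hb.subset h
  have h2 : z ∈ x → z ∈ a := fun h => ha.subset h
  simp only [mem_union, Finset.mem_sdiff]
  tauto

/-- If the complement y of x in [b, a] were in F, then x, y and everything above x would lie above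
b, and dually below a. The degrees of x would then be at most L - 2 and K - 2, too small for a heavy
member. -/
lemma disjoint_complements (hK4 : K ≤ 4) (hL4 : L ≤ 4)
    (hK : ∀ A ∈ F, #(below F A) ≤ K) (hL : ∀ A ∈ F, #(above F A) ≤ L) :
    Disjoint F (complements F K L) := by
  rw [disjoint_left]
  intro y hyF hy
  obtain ⟨x, hx, b, hb, a, ha, rfl⟩ := mem_complements.1 hy
  obtain ⟨hxF, hheavy⟩ := mem_filter.1 hx
  rw [mem_below] at hb
  rw [mem_above] at ha
  set y := b ∪ (a \ x) with hydef
  have hby : b ⊂ y := ssubset_union_sdiff hb.2 ha.2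
  have hya : y ⊂ a := union_sdiff_ssubset hb.2 ha.2
  have hxy : ¬ x ⊆ y := by
    obtain ⟨z, hz, hzb⟩ := exists_of_ssubset hb.2
    exact fun h => by simpa [hydef, hzb, hz] using h hz
  have hyx : ¬ y ⊆ x := by
    obtain ⟨z, hz, hzx⟩ := exists_of_ssubset ha.2
    exact fun h => hzx (h (by simp [hydef, hz, hzx]))
  have hne : x ≠ y := fun h => hxy h.subset
  have hup : #(above F x) + 2 ≤ L := by
    refine le_trans ?_ (hL b hb.1)
    rw [← card_pair hne, ← card_union_of_disjoint]
    · refine card_le_card (union_subset (above_anti hb.2.subset) ?_)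
      intro z hz
      rcases mem_insert.1 hz with rfl | hz
      · exact mem_above.2 ⟨hxF, hb.2⟩
      · exact mem_above.2 ⟨mem_singleton.1 hz ▸ hyF, mem_singleton.1 hz ▸ hby⟩
    · rw [disjoint_right]
      intro z hz hz'
      rcases mem_insert.1 hz with rfl | hz
      · exact (mem_above.1 hz').2.ne rfl
      · rw [mem_singleton.1 hz] at hz'
        exact hxy (mem_above.1 hz').2.subset
  have hdown : #(below F x) + 2 ≤ K := by
    refine le_trans ?_ (hK a ha.1)
    rw [← card_pair hne, ← card_union_of_disjoint]
    · refine card_le_card (union_subset (below_mono ha.2.subset) ?_)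
      intro z hz
      rcases mem_insert.1 hz with rfl | hz
      · exact mem_below.2 ⟨hxF, ha.2⟩
      · exact mem_below.2 ⟨mem_singleton.1 hz ▸ hyF, mem_singleton.1 hz ▸ hya⟩
    · rw [disjoint_right]
      intro z hz hz'
      rcases mem_insert.1 hz with rfl | hz
      · exact (mem_below.1 hz').2.ne rfl
      · rw [mem_singleton.1 hz] at hz'
        exact hyx (mem_below.1 hz').2.subset
  -- The only use of the bound 4: K - 2 ≤ K/2 exactly when K ≤ 4, and likewise for L.
  have h1 : 2 * #(below F x) ≤ K := by omega
  have h2 : 2 * #(above F x) ≤ L := by omega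
  nlinarith

/-- Complementation in [b, a] is an involution, so (x, b, a) ↦ (b ∪ (a \ x), b, a) is injective.
Each complement lies between members of F and so inherits the degree bounds K and L relative to F.
-/
lemma sum_heavy_le (hK : ∀ A ∈ F, #(below F A) ≤ K) (hL : ∀ A ∈ F, #(above F A) ≤ L) :
    ∑ x ∈ heavy F K L, #(below F x) * #(above F x) ≤ K * L * #(complements F K L) := by
  calc ∑ x ∈ heavy F K L, #(below F x) * #(above F x)
      = #((heavy F K L).sigma fun x => below F x ×ˢ above F x) := by
        simp [card_sigma]
    _ ≤ #((complements F K L).sigma fun y => below F y ×ˢ above F y) := by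
        refine card_le_card_of_injOn
          (fun p => ⟨p.2.1 ∪ (p.2.2 \ p.1), p.2.1, p.2.2⟩) ?_ ?_
        · rintro ⟨x, b, a⟩ h
          simp only [mem_coe, mem_sigma, mem_product] at h ⊢
          obtain ⟨hx, hb, ha⟩ := h
          refine ⟨mem_complements.2 ⟨x, hx, b, hb, a, ha, rfl⟩, ?_, ?_⟩
          · exact mem_below.2 ⟨(mem_below.1 hb).1,
              ssubset_union_sdiff (mem_below.1 hb).2 (mem_above.1 ha).2⟩
          · exact mem_above.2 ⟨(mem_above.1 ha).1,
              union_sdiff_ssubset (mem_below.1 hb).2 (mem_above.1 ha).2⟩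
        · rintro ⟨x, b, a⟩ h ⟨x', b', a'⟩ h' heq
          simp only [mem_coe, mem_sigma, mem_product] at h h'
          simp only [Sigma.mk.injEq, heq_eq_eq, Prod.mk.injEq] at heq
          obtain ⟨h1, rfl, rfl⟩ := heq
          have : x = x' := by
            rw [← union_sdiff_union_sdiff (mem_below.1 h.2.1).2 (mem_above.1 h.2.2).2, h1,
              union_sdiff_union_sdiff (mem_below.1 h'.2.1).2 (mem_above.1 h'.2.2).2]
          rw [this]
    _ = ∑ y ∈ complements F K L, #(below F y) * #(above F y) := by
        simp [card_sigma]
    _ ≤ ∑ _y ∈ complements F K L, K * L := by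
        refine sum_le_sum fun y hy => ?_
        obtain ⟨x, hx, b, hb, a, ha, rfl⟩ := mem_complements.1 hy
        rw [mem_below] at hb
        rw [mem_above] at ha
        exact Nat.mul_le_mul
          ((card_le_card (below_mono (union_sdiff_ssubset hb.2 ha.2).subset)).trans (hK a ha.1))
          ((card_le_card (above_anti (ssubset_union_sdiff hb.2 ha.2).subset)).trans (hL b hb.1))
    _ = _ := by rw [sum_const, smul_eq_mul, mul_comm]

lemma sum_card_below_le (hK4 : K ≤ 4) (hL4 : L ≤ 4)
    (hK : ∀ A ∈ F, #(below F A) ≤ K) (hL : ∀ A ∈ F, #(above F A) ≤ L) :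
    (K + L) * ∑ A ∈ F, #(below F A) ≤ K * L * #(F ∪ complements F K L) := by
  have h1 : (K + L) * ∑ A ∈ F, #(below F A) =
      ∑ x ∈ F, (#(below F x) * L + #(above F x) * K) := by
    rw [sum_add_distrib, ← sum_mul, ← sum_mul, sum_card_above_eq_sum_card_below]
    ring
  have h2 : ∑ x ∈ F, (#(below F x) * L + #(above F x) * K) ≤
      ∑ x ∈ F, (K * L + if K * L < #(below F x) * L + #(above F x) * K then
        #(below F x) * #(above F x) else 0) := by
    refine sum_le_sum fun x hx => ?_
    split_ifs with h
    -- With degrees i = K - c and j = L - d, the excess iL + jK - KL equals ij - cd, hence is at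
    -- most ij.
    · obtain ⟨c, hc⟩ := Nat.exists_eq_add_of_le (hK x hx)
      obtain ⟨d, hd⟩ := Nat.exists_eq_add_of_le (hL x hx)
      generalize #(below F x) = i at *
      generalize #(above F x) = j at *
      subst hc hd
      nlinarith [Nat.zero_le (c * d)]
    · omega
  have h4 : ∑ x ∈ F, (K * L + if K * L < #(below F x) * L + #(above F x) * K then
      #(below F x) * #(above F x) else 0) =
      #F * (K * L) + ∑ x ∈ heavy F K L, #(below F x) * #(above F x) := by
    rw [sum_add_distrib, ← sum_filter, sum_const, smul_eq_mul, heavy]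
  rw [h4] at h2
  have h3 := sum_heavy_le hK hL
  rw [card_union_of_disjoint (disjoint_complements hK4 hL4 hK hL), h1, mul_add, mul_comm (K * L)]
  exact h2.trans (Nat.add_le_add_left h3 _)

lemma exists_mem_subset_of_mem_union {z : Finset α} (hz : z ∈ F ∪ complements F K L) :
    ∃ b ∈ F, b ⊆ z := by
  rcases mem_union.1 hz with hz | hz
  · exact ⟨z, hz, Subset.rfl⟩
  · obtain ⟨x, hx, b, hb, a, ha, rfl⟩ := mem_complements.1 hz
    exact ⟨b, (mem_below.1 hb).1, subset_union_left⟩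

lemma exists_mem_superset_of_mem_union {z : Finset α} (hz : z ∈ F ∪ complements F K L) :
    ∃ a ∈ F, z ⊆ a := by
  rcases mem_union.1 hz with hz | hz
  · exact ⟨z, hz, Subset.rfl⟩
  · obtain ⟨x, hx, b, hb, a, ha, rfl⟩ := mem_complements.1 hz
    exact ⟨a, (mem_above.1 ha).1,
      (union_sdiff_ssubset (mem_below.1 hb).2 (mem_above.1 ha).2).subset⟩

/-- Take c in F below z. A complement b ∪ (a \ x) above z forces a above c, leaving L choices of a,
then K of x below a, then K of b below x. -/
lemma card_above_union_complements_le (hK : ∀ A ∈ F, #(below F A) ≤ K)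
    (hL : ∀ A ∈ F, #(above F A) ≤ L) {z : Finset α} (hz : z ∈ F ∪ complements F K L) :
    #(above (F ∪ complements F K L) z) ≤ L + L * (K * K) := by
  obtain ⟨c, hcF, hcz⟩ := exists_mem_subset_of_mem_union hz
  have hsub : above (F ∪ complements F K L) z ⊆ above F c ∪ (above F c).biUnion fun a =>
      (below F a).biUnion fun x => (below F x).image fun b => b ∪ (a \ x) := by
    intro y hy
    rw [mem_above, mem_union] at hy
    rcases hy with ⟨hy | hy, hzy⟩
    · exact mem_union_left _ (mem_above.2 ⟨hy, hcz.trans_ssubset hzy⟩)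
    · obtain ⟨x, hx, b, hb, a, ha, rfl⟩ := mem_complements.1 hy
      have ha' := mem_above.1 ha
      refine mem_union_right _ (mem_biUnion.2 ⟨a, mem_above.2 ⟨ha'.1, ?_⟩,
        mem_biUnion.2 ⟨x, mem_below.2 ⟨(mem_filter.1 hx).1, ha'.2⟩, mem_image.2 ⟨b, hb, rfl⟩⟩⟩)
      exact (hcz.trans_ssubset hzy).trans (union_sdiff_ssubset (mem_below.1 hb).2 ha'.2)
  refine (card_le_card hsub).trans ((card_union_le _ _).trans (Nat.add_le_add (hL c hcF) ?_))
  refine (card_biUnion_le_card_mul _ _ (K * K) fun a ha => ?_).trans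
    (Nat.mul_le_mul_right _ (hL c hcF))
  refine (card_biUnion_le_card_mul _ _ K fun x hx => ?_).trans
    (Nat.mul_le_mul_right _ (hK a (mem_above.1 ha).1))
  exact card_image_le.trans (hK x (mem_below.1 hx).1)

lemma card_below_union_complements_le (hK : ∀ A ∈ F, #(below F A) ≤ K)
    (hL : ∀ A ∈ F, #(above F A) ≤ L) {z : Finset α} (hz : z ∈ F ∪ complements F K L) :
    #(below (F ∪ complements F K L) z) ≤ K + K * (L * L) := by
  obtain ⟨c, hcF, hcz⟩ := exists_mem_superset_of_mem_union hz
  have hsub : below (F ∪ complements F K L) z ⊆ below F c ∪ (below F c).biUnion fun b =>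
      (above F b).biUnion fun x => (above F x).image fun a => b ∪ (a \ x) := by
    intro y hy
    rw [mem_below, mem_union] at hy
    rcases hy with ⟨hy | hy, hzy⟩
    · exact mem_union_left _ (mem_below.2 ⟨hy, hzy.trans_subset hcz⟩)
    · obtain ⟨x, hx, b, hb, a, ha, rfl⟩ := mem_complements.1 hy
      have hb' := mem_below.1 hb
      refine mem_union_right _ (mem_biUnion.2 ⟨b, mem_below.2 ⟨hb'.1, ?_⟩,
        mem_biUnion.2 ⟨x, mem_above.2 ⟨(mem_filter.1 hx).1, hb'.2⟩, mem_image.2 ⟨a, ha, rfl⟩⟩⟩)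
      exact (ssubset_union_sdiff hb'.2 (mem_above.1 ha).2).trans (hzy.trans_subset hcz)
  refine (card_le_card hsub).trans ((card_union_le _ _).trans (Nat.add_le_add (hK c hcF) ?_))
  refine (card_biUnion_le_card_mul _ _ (L * L) fun a ha => ?_).trans
    (Nat.mul_le_mul_right _ (hK c hcF))
  refine (card_biUnion_le_card_mul _ _ L fun x hx => ?_).trans
    (Nat.mul_le_mul_right _ (hL a (mem_below.1 ha).1))
  exact card_image_le.trans (hL x (mem_above.1 hx).1)

/-- The number of copies of `∧_s` is controlled by the size of a family whose comparability
degrees are bounded in terms of `K` and `L`. -/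
lemma exists_sum_choose_below_le {s : ℕ} (hs : 1 ≤ s) (hsK : s ≤ K)
    (h : s = K ∨ (K ≤ 4 ∧ L ≤ 4))
    (hK : ∀ A ∈ F, #(below F A) ≤ K) (hL : ∀ A ∈ F, #(above F A) ≤ L) :
    ∃ H : Finset (Finset α),
      (∀ A ∈ H, #(below H A) ≤ K + L + K * (L * L) + L * (K * K) ∧
        #(above H A) ≤ K + L + K * (L * L) + L * (K * K)) ∧
      (K + L) * ∑ A ∈ F, (#(below F A)).choose s ≤ K.choose s * L * #H := by
  rcases h with rfl | ⟨hK4, hL4⟩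
  · refine ⟨F, fun A hA => ⟨?_, ?_⟩, ?_⟩
    · have := hK A hA
      omega
    · have := hL A hA
      omega
    · simpa using sum_choose_below_top_le hK hL
  · refine ⟨F ∪ complements F K L, fun A hA => ⟨?_, ?_⟩, ?_⟩
    · have := card_below_union_complements_le hK hL hA
      omega
    · have := card_above_union_complements_le hK hL hA
      omega
    · refine Nat.le_of_mul_le_mul_left (c := K) ?_ (by omega : 0 < K)
      have h1 : K * ∑ A ∈ F, (#(below F A)).choose s ≤
          K.choose s * ∑ A ∈ F, #(below F A) := by
        rw [mul_sum, mul_sum]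
        exact sum_le_sum fun A hA => mul_choose_le_choose_mul hs (hK A hA)
      calc K * ((K + L) * ∑ A ∈ F, (#(below F A)).choose s)
          = (K + L) * (K * ∑ A ∈ F, (#(below F A)).choose s) := by ring
        _ ≤ (K + L) * (K.choose s * ∑ A ∈ F, #(below F A)) := Nat.mul_le_mul_left _ h1
        _ = K.choose s * ((K + L) * ∑ A ∈ F, #(below F A)) := by ring
        _ ≤ K.choose s * (K * L * #(F ∪ complements F K L)) :=
            Nat.mul_le_mul_left _ (sum_card_below_le hK4 hL4 hK hL)
        _ = _ := by ring

end Bounds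

/-! ### Lower bound: the biregular block construction -/

section Blocks
variable {α : Type*} [DecidableEq α] {blk : α → ℕ} {A : Finset α} {i t q L p : ℕ}

/-- The number of elements of `A` in the block of index `i`. -/
def blockCount (blk : α → ℕ) (i : ℕ) (A : Finset α) : ℕ := #(A.filter fun x => blk x = i)

/-- The block of index `i < t` is the first of the blocks that `A` meets in `q` or `q + 1`
elements. -/
def IsFirstGood (blk : α → ℕ) (q t i : ℕ) (A : Finset α) : Prop :=
  i < t ∧ ∀ j < i, blockCount blk j A ≠ q ∧ blockCount blk j A ≠ q + 1

/-- The first block that `A` meets in `q` or `q + 1` elements exists and meets `A` in `q`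
elements. -/
def IsBottom (blk : α → ℕ) (q t : ℕ) (A : Finset α) : Prop :=
  ∃ i, IsFirstGood blk q t i A ∧ blockCount blk i A = q

/-- The first block that `A` meets in `q` or `q + 1` elements exists and meets `A` in `q + 1`
elements. -/
def IsTop (blk : α → ℕ) (q t : ℕ) (A : Finset α) : Prop :=
  ∃ i, IsFirstGood blk q t i A ∧ blockCount blk i A = q + 1

lemma blockCount_insert_self {x : α} (hx : x ∉ A) :
    blockCount blk (blk x) (insert x A) = blockCount blk (blk x) A + 1 := by
  rw [blockCount, filter_insert, if_pos rfl, card_insert_of_notMem (by simp [hx])]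
  rfl

lemma blockCount_insert_of_ne {x : α} (h : blk x ≠ i) :
    blockCount blk i (insert x A) = blockCount blk i A := by
  rw [blockCount, filter_insert, if_neg h]
  rfl

/-- A bottom set and a top set differing by one element share their first good block, and that
element lies in it. This makes the degrees exact. -/
lemma blk_eq_of_insert {i' : ℕ} {x : α} (hx : x ∉ A) (hi : IsFirstGood blk q t i A)
    (hiA : blockCount blk i A = q) (hi' : IsFirstGood blk q t i' (insert x A))
    (hiA' : blockCount blk i' (insert x A) = q + 1) : blk x = i ∧ blk x = i' := by
  have hii' : blk x = i' := by
    by_contra hne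
    rw [blockCount_insert_of_ne hne] at hiA'
    rcases lt_trichotomy i i' with h | h | h
    · have h1 := hi'.2 i h
      by_cases hxi : blk x = i
      · subst hxi
        rw [blockCount_insert_self hx] at h1
        omega
      · rw [blockCount_insert_of_ne hxi] at h1
        omega
    · subst h
      omega
    · exact (hi.2 i' h).2 hiA'
  refine ⟨?_, hii'⟩
  subst hii'
  rw [blockCount_insert_self hx] at hiA'
  by_contra hne
  rcases lt_or_gt_of_ne hne with h | h
  · exact (hi.2 _ h).1 (by omega)
  · have h1 := hi'.2 i h
    rw [blockCount_insert_of_ne hne] at h1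
    exact h1.1 hiA

lemma IsFirstGood.insert {x : α} (hi : IsFirstGood blk q t (blk x) A) :
    IsFirstGood blk q t (blk x) (insert x A) :=
  ⟨hi.1, fun j hj => by rw [blockCount_insert_of_ne hj.ne']; exact hi.2 j hj⟩

lemma IsFirstGood.of_insert {x : α} (hi : IsFirstGood blk q t (blk x) (Insert.insert x A)) :
    IsFirstGood blk q t (blk x) A :=
  ⟨hi.1, fun j hj => by
    have := hi.2 j hj
    rwa [blockCount_insert_of_ne hj.ne'] at this⟩

variable [Fintype α]

open Classical in
/-- The bottom sets of size `p`. -/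
noncomputable def bottoms (blk : α → ℕ) (q t p : ℕ) : Finset (Finset α) :=
  univ.filter fun A => #A = p ∧ IsBottom blk q t A

open Classical in
/-- The top sets of size `p`. -/
noncomputable def tops (blk : α → ℕ) (q t p : ℕ) : Finset (Finset α) :=
  univ.filter fun A => #A = p ∧ IsTop blk q t A

omit [DecidableEq α] in
lemma mem_bottoms : A ∈ bottoms blk q t p ↔ #A = p ∧ IsBottom blk q t A := by simp [bottoms]

omit [DecidableEq α] in
lemma mem_tops : A ∈ tops blk q t p ↔ #A = p ∧ IsTop blk q t A := by simp [tops]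

/-- The top sets of size `p + 1` together with the bottom sets of size `p`. -/
noncomputable def blockFamily (blk : α → ℕ) (q t p : ℕ) : Finset (Finset α) :=
  tops blk q t (p + 1) ∪ bottoms blk q t p

lemma card_of_mem_blockFamily (hA : A ∈ blockFamily blk q t p) : p ≤ #A ∧ #A ≤ p + 1 := by
  rcases mem_union.1 hA with h | h
  · rw [(mem_tops.1 h).1]
    omega
  · rw [(mem_bottoms.1 h).1]
    omega

omit [DecidableEq α] in
lemma disjoint_tops_bottoms : Disjoint (tops blk q t (p + 1)) (bottoms blk q t p) := by
  rw [disjoint_left]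
  intro A h h'
  have h1 := (mem_tops.1 h).1
  have h2 := (mem_bottoms.1 h').1
  omega

lemma above_blockFamily_of_mem_tops (hA : A ∈ tops blk q t (p + 1)) :
    above (blockFamily blk q t p) A = ∅ := by
  refine eq_empty_of_forall_notMem fun B hB => ?_
  rw [mem_above] at hB
  have h1 := (mem_tops.1 hA).1
  have h2 := card_lt_card hB.2
  have h3 := card_of_mem_blockFamily hB.1
  omega

lemma below_blockFamily_of_mem_bottoms (hA : A ∈ bottoms blk q t p) :
    below (blockFamily blk q t p) A = ∅ := by
  refine eq_empty_of_forall_notMem fun B hB => ?_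
  rw [mem_below] at hB
  have h1 := (mem_bottoms.1 hA).1
  have h2 := card_lt_card hB.2
  have h3 := card_of_mem_blockFamily hB.1
  omega

lemma card_below_of_mem_tops (hA : A ∈ tops blk q t (p + 1)) :
    #(below (blockFamily blk q t p) A) = q + 1 := by
  obtain ⟨hcard, i, hi, hiA⟩ := mem_tops.1 hA
  have : below (blockFamily blk q t p) A = (A.filter fun x => blk x = i).image A.erase := by
    ext B
    rw [mem_below, mem_image]
    constructor
    · rintro ⟨hB, hBA⟩
      have hlt := card_lt_card hBA
      have hB' : B ∈ bottoms blk q t p := (mem_union.1 hB).resolve_left fun h => by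
        have := (mem_tops.1 h).1
        omega
      obtain ⟨hBcard, i', hi', hiB⟩ := mem_bottoms.1 hB'
      obtain ⟨x, hx, rfl⟩ : ∃ x, x ∉ B ∧ insert x B = A := by
        have h1 := card_sdiff_add_card_eq_card hBA.subset
        obtain ⟨x, hx⟩ := card_eq_one.1 (show #(A \ B) = 1 by omega)
        refine ⟨x, (Finset.mem_sdiff.1 (hx ▸ mem_singleton_self x)).2, ?_⟩
        rw [insert_eq, ← hx, sdiff_union_of_subset hBA.subset]
      exact ⟨x, mem_filter.2 ⟨mem_insert_self _ _, (blk_eq_of_insert hx hi' hiB hi hiA).2⟩,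
        erase_insert hx⟩
    · rintro ⟨x, hx, rfl⟩
      obtain ⟨hxA, rfl⟩ := mem_filter.1 hx
      rw [← insert_erase hxA] at hi hiA
      rw [blockCount_insert_self (notMem_erase x A)] at hiA
      refine ⟨mem_union_right _ (mem_bottoms.2 ⟨?_, blk x, hi.of_insert, by omega⟩),
        erase_ssubset hxA⟩
      rw [card_erase_of_mem hxA]
      omega
  rw [this, card_image_of_injOn]
  · exact hiA
  · exact (erase_injOn A).mono fun x hx => (mem_filter.1 hx).1

lemma card_above_of_mem_bottoms (hblk : ∀ i < t, #(univ.filter fun x => blk x = i) = q + L)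
    (hA : A ∈ bottoms blk q t p) :
    #(above (blockFamily blk q t p) A) = L := by
  obtain ⟨hcard, i, hi, hiA⟩ := mem_bottoms.1 hA
  have : above (blockFamily blk q t p) A =
      ((univ.filter fun x => blk x = i) \ A).image fun x => insert x A := by
    ext B
    rw [mem_above, mem_image]
    constructor
    · rintro ⟨hB, hAB⟩
      have hlt := card_lt_card hAB
      have hB' : B ∈ tops blk q t (p + 1) := (mem_union.1 hB).resolve_right fun h => by
        have := (mem_bottoms.1 h).1
        omega
      obtain ⟨hBcard, i', hi', hiB⟩ := mem_tops.1 hB'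
      obtain ⟨x, hx, rfl⟩ : ∃ x, x ∉ A ∧ insert x A = B := by
        have h1 := card_sdiff_add_card_eq_card hAB.subset
        obtain ⟨x, hx⟩ := card_eq_one.1 (show #(B \ A) = 1 by omega)
        refine ⟨x, (Finset.mem_sdiff.1 (hx ▸ mem_singleton_self x)).2, ?_⟩
        rw [insert_eq, ← hx, sdiff_union_of_subset hAB.subset]
      exact ⟨x, Finset.mem_sdiff.2 ⟨mem_filter.2 ⟨mem_univ _,
        (blk_eq_of_insert hx hi hiA hi' hiB).1⟩, hx⟩, rfl⟩
    · rintro ⟨x, hx, rfl⟩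
      obtain ⟨hx, hxA⟩ := Finset.mem_sdiff.1 hx
      obtain ⟨-, rfl⟩ := mem_filter.1 hx
      refine ⟨mem_union_left _ (mem_tops.2 ⟨?_, blk x, hi.insert, ?_⟩), ssubset_insert hxA⟩
      · rw [card_insert_of_notMem hxA, hcard]
      · rw [blockCount_insert_self hxA, hiA]
  rw [this, card_image_of_injOn]
  · have h1 := card_sdiff_add_card_inter (univ.filter fun x => blk x = i) A
    have h2 : (univ.filter fun x => blk x = i) ∩ A = A.filter fun x => blk x = i := by
      ext x
      simp [and_comm]
    rw [h2, hblk i hi.1] at h1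
    rw [blockCount] at hiA
    omega
  · exact (insert_inj_on A).mono fun x hx => (Finset.mem_sdiff.1 hx).2

lemma blockFamily_degree_le (hblk : ∀ i < t, #(univ.filter fun x => blk x = i) = q + L)
    (hA : A ∈ blockFamily blk q t p) :
    #(below (blockFamily blk q t p) A) ≤ q + 1 ∧ #(above (blockFamily blk q t p) A) ≤ L := by
  rcases mem_union.1 hA with h | h
  · rw [card_below_of_mem_tops h, above_blockFamily_of_mem_tops h]
    simp
  · rw [card_above_of_mem_bottoms hblk h, below_blockFamily_of_mem_bottoms h]
    simp

/-- Edges of the bipartite inclusion graph counted from both sides. -/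
lemma mul_card_tops_eq_mul_card_bottoms
    (hblk : ∀ i < t, #(univ.filter fun x => blk x = i) = q + L) :
    (q + 1) * #(tops blk q t (p + 1)) = L * #(bottoms blk q t p) := by
  have h := sum_card_above_eq_sum_card_below (blockFamily blk q t p)
  rw [blockFamily, sum_union disjoint_tops_bottoms, sum_union disjoint_tops_bottoms,
    ← blockFamily,
    sum_congr rfl fun A hA => congrArg card (above_blockFamily_of_mem_tops hA),
    sum_congr rfl fun A hA => congrArg card (below_blockFamily_of_mem_bottoms hA),
    sum_congr rfl fun A hA => card_below_of_mem_tops hA,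
    sum_congr rfl fun A hA => card_above_of_mem_bottoms hblk hA] at h
  simp only [card_empty, sum_const_zero, sum_const, smul_eq_mul, zero_add, add_zero] at h
  rw [mul_comm, ← h, mul_comm]

lemma choose_mul_card_tops_le_sum {s : ℕ} :
    (q + 1).choose s * #(tops blk q t (p + 1)) ≤
      ∑ A ∈ blockFamily blk q t p, (#(below (blockFamily blk q t p) A)).choose s := by
  calc (q + 1).choose s * #(tops blk q t (p + 1))
      = ∑ A ∈ tops blk q t (p + 1), (#(below (blockFamily blk q t p) A)).choose s := by
        rw [sum_congr rfl fun A hA => congrArg (Nat.choose · s) (card_below_of_mem_tops hA),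
          sum_const, smul_eq_mul, mul_comm]
    _ ≤ _ := sum_le_sum_of_subset subset_union_left

open Classical in
/-- The sets that meet each of the first `t` blocks in a number of elements other than `q` and
`q + 1`. -/
noncomputable def badSets (blk : α → ℕ) (q t : ℕ) : Finset (Finset α) :=
  univ.filter fun A => ∀ i < t, blockCount blk i A ≠ q ∧ blockCount blk i A ≠ q + 1

open Classical in
-- Every set is top, bottom or bad, and summing the biregular identity over all levels gives (q +
-- 1)·tops = L·bottoms.
lemma mul_two_pow_le (hblk : ∀ i < t, #(univ.filter fun x => blk x = i) = q + L) :
    L * 2 ^ Fintype.card α ≤ (q + 1 + L) * #(univ.filter (IsTop blk q t)) +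
      L * #(badSets blk q t) := by
  have hcover : (univ : Finset (Finset α)) ⊆
      univ.filter (IsTop blk q t) ∪ univ.filter (IsBottom blk q t) ∪ badSets blk q t := by
    intro A _
    by_cases hbad : A ∈ badSets blk q t
    · exact mem_union_right _ hbad
    refine mem_union_left _ ?_
    simp only [badSets, mem_filter, mem_univ, true_and, not_forall] at hbad
    have hex : ∃ i, i < t ∧ ¬ (blockCount blk i A ≠ q ∧ blockCount blk i A ≠ q + 1) := by
      obtain ⟨i, hi, h⟩ := hbad
      exact ⟨i, hi, h⟩
    have hspec := Nat.find_spec hex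
    have hfirst : IsFirstGood blk q t (Nat.find hex) A := ⟨hspec.1, fun j hj => by
      by_contra hc
      exact Nat.find_min hex hj ⟨hj.trans hspec.1, hc⟩⟩
    by_cases hq : blockCount blk (Nat.find hex) A = q
    · exact mem_union_right _ (mem_filter.2 ⟨mem_univ _, _, hfirst, hq⟩)
    · refine mem_union_left _ (mem_filter.2 ⟨mem_univ _, _, hfirst, ?_⟩)
      by_contra hq'
      exact hspec.2 ⟨hq, hq'⟩
  have hcard : 2 ^ Fintype.card α ≤ #(univ.filter (IsTop blk q t)) +
      #(univ.filter (IsBottom blk q t)) + #(badSets blk q t) := by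
    rw [← Fintype.card_finset, ← card_univ]
    exact (card_le_card hcover).trans ((card_union_le _ _).trans
      (Nat.add_le_add_right (card_union_le _ _) _))
  have htop : #(univ.filter (IsTop blk q t)) =
      ∑ p ∈ range (Fintype.card α + 1), #(tops blk q t (p + 1)) := by
    have h1 : ∀ A ∈ univ.filter (IsTop blk q t), #A ∈ range (Fintype.card α + 2) :=
      fun A _ => mem_range.2 (by have := A.card_le_univ; omega)
    rw [card_eq_sum_card_fiberwise h1, sum_range_succ']
    -- Level 0 contains no top set, so the sum over top levels can be shifted by one to match the
    -- bottoms.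
    have h0 : #((univ.filter (IsTop blk q t)).filter fun A => #A = 0) = 0 := by
      rw [card_eq_zero]
      refine eq_empty_of_forall_notMem fun A hA => ?_
      rw [mem_filter, mem_filter] at hA
      obtain ⟨⟨-, i, -, hi⟩, hA0⟩ := hA
      rw [card_eq_zero.1 hA0] at hi
      simp [blockCount] at hi
    rw [h0, add_zero]
    refine sum_congr rfl fun p _ => congrArg card ?_
    ext A
    simp [mem_tops, and_comm]
  have hbot : #(univ.filter (IsBottom blk q t)) =
      ∑ p ∈ range (Fintype.card α + 1), #(bottoms blk q t p) := by
    have h1 : ∀ A ∈ univ.filter (IsBottom blk q t), #A ∈ range (Fintype.card α + 1) :=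
      fun A _ => mem_range.2 (by have := A.card_le_univ; omega)
    rw [card_eq_sum_card_fiberwise h1]
    refine sum_congr rfl fun p _ => congrArg card ?_
    ext A
    simp [mem_bottoms, and_comm]
  have hprop : (q + 1) * #(univ.filter (IsTop blk q t)) =
      L * #(univ.filter (IsBottom blk q t)) := by
    rw [htop, hbot, mul_sum, mul_sum]
    exact sum_congr rfl fun p _ => mul_card_tops_eq_mul_card_bottoms hblk
  nlinarith [Nat.mul_le_mul_left L hcard]

end Blocks

/-! ### Transferring the blocks into a large ground set -/

section Trace
variable {t N q p : ℕ}

/-- The block index on a product `Fin t × Fin N`. -/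
def prodBlk (t N : ℕ) (x : Fin t × Fin N) : ℕ := x.1

lemma card_filter_prodBlk {i : ℕ} (hi : i < t) :
    #(univ.filter fun x => prodBlk t N x = i) = N := by
  have : (univ.filter fun x => prodBlk t N x = i) =
      ({⟨i, hi⟩} : Finset (Fin t)) ×ˢ (univ : Finset (Fin N)) := by
    ext ⟨j, y⟩
    simp only [mem_filter, mem_product, mem_singleton, mem_univ, true_and, and_true]
    exact (Fin.ext_iff (a := j) (b := ⟨i, hi⟩)).symm
  rw [this, card_product]
  simp

lemma card_badSets_le (hq : q ≤ N) :
    #(badSets (prodBlk t N) q t) ≤ (2 ^ N - 1) ^ t := by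
  classical
  -- Forbidding size q already excludes at least one of the 2^N traces on each block, which suffices
  -- for exponential decay in t.
  have hS : #(univ.filter fun S : Finset (Fin N) => #S ≠ q) ≤ 2 ^ N - 1 := by
    obtain ⟨S, -, hScard⟩ := exists_subset_card_eq (s := (univ : Finset (Fin N))) (n := q)
      (by simpa using hq)
    have : (univ.filter fun S : Finset (Fin N) => #S ≠ q) ⊆ univ.erase S := fun T hT =>
      mem_erase.2 ⟨fun h => (mem_filter.1 hT).2 (h ▸ hScard), mem_univ _⟩
    refine (card_le_card this).trans ?_
    rw [card_erase_of_mem (mem_univ _), card_univ, Fintype.card_finset, Fintype.card_fin]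
  refine le_trans ?_ (Nat.pow_le_pow_left hS t)
  have hpi : #(univ.filter fun S : Finset (Fin N) => #S ≠ q) ^ t =
      #(Fintype.piFinset fun _ : Fin t => univ.filter fun S : Finset (Fin N) => #S ≠ q) := by
    simp
  rw [hpi]
  refine card_le_card_of_injOn (fun A i => univ.filter fun j => (i, j) ∈ A) ?_ ?_
  · intro A hA
    rw [mem_coe, badSets, mem_filter] at hA
    rw [mem_coe, Fintype.mem_piFinset]
    intro i
    rw [mem_filter]
    refine ⟨mem_univ _, ?_⟩
    have h := (hA.2 i i.2).1
    rw [blockCount] at h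
    convert h using 1
    refine card_bij (fun j _ => (i, j)) ?_ ?_ ?_
    · intro j hj
      exact mem_filter.2 ⟨(mem_filter.1 hj).2, rfl⟩
    · intro j _ j' _ h
      exact (Prod.mk.inj h).2
    · rintro ⟨i', j⟩ h
      obtain ⟨hA, hi⟩ := mem_filter.1 h
      obtain rfl : i' = i := Fin.ext hi
      exact ⟨j, mem_filter.2 ⟨mem_univ _, hA⟩, rfl⟩
  · intro A _ B _ h
    ext ⟨i, j⟩
    have := congrArg (fun S => j ∈ S) (congrFun h i)
    simpa using this

variable {α : Type*} [DecidableEq α] [Fintype α] (e : Fin t × Fin N ↪ α)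

/-- The trace of `A` on the image of `e`. -/
def trace (A : Finset α) : Finset (Fin t × Fin N) := univ.filter fun x => e x ∈ A

/-- The block index transported along `e`, with value `t` off the image of `e`. -/
noncomputable def embBlk : α → ℕ := Function.extend e (prodBlk t N) fun _ => t

omit [DecidableEq α] [Fintype α] in
lemma embBlk_apply (x : Fin t × Fin N) : embBlk e (e x) = prodBlk t N x :=
  e.injective.extend_apply _ _ _

omit [Fintype α] in
lemma filter_embBlk {i : ℕ} (hi : i < t) (A : Finset α) :
    (A.filter fun y => embBlk e y = i) =
      ((trace e A).filter fun x => prodBlk t N x = i).map e := by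
  ext y
  simp only [mem_filter, Finset.mem_map, trace, mem_univ, true_and]
  constructor
  · rintro ⟨hyA, hy⟩
    by_cases hex : ∃ x, e x = y
    · obtain ⟨x, rfl⟩ := hex
      exact ⟨x, ⟨hyA, by rwa [embBlk_apply] at hy⟩, rfl⟩
    · rw [embBlk, Function.extend_apply' _ _ _ hex] at hy
      omega
  · rintro ⟨x, ⟨hx, hxi⟩, rfl⟩
    exact ⟨hx, by rwa [embBlk_apply]⟩

omit [Fintype α] in
lemma blockCount_embBlk {i : ℕ} (hi : i < t) (A : Finset α) :
    blockCount (embBlk e) i A = blockCount (prodBlk t N) i (trace e A) := by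
  rw [blockCount, blockCount, filter_embBlk e hi, card_map]

lemma card_filter_embBlk {i : ℕ} (hi : i < t) :
    #(univ.filter fun y => embBlk e y = i) = N := by
  have : trace e univ = univ := by simp [trace]
  rw [filter_embBlk e hi, this, card_map, card_filter_prodBlk hi]

omit [Fintype α] in
lemma isTop_embBlk {A : Finset α} (h : IsTop (prodBlk t N) q t (trace e A)) :
    IsTop (embBlk e) q t A := by
  obtain ⟨i, hi, hiA⟩ := h
  refine ⟨i, ⟨hi.1, fun j hj => ?_⟩, ?_⟩
  · rw [blockCount_embBlk e (hj.trans hi.1)]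
    exact hi.2 j hj
  · rwa [blockCount_embBlk e hi.1]

/-- A set with trace τ is completed freely by p - |τ| elements outside the blocks. -/
lemma choose_le_card_filter_trace {τ : Finset (Fin t × Fin N)} (hτ : #τ ≤ p) :
    (Fintype.card α - t * N).choose (p - #τ) ≤
      #(univ.filter fun A : Finset α => #A = p ∧ trace e A = τ) := by
  have hM : #((univ.map e)ᶜ : Finset α) = Fintype.card α - t * N := by
    rw [card_compl, card_map, card_univ, Fintype.card_prod, Fintype.card_fin, Fintype.card_fin]
  rw [← hM, ← card_powersetCard]
  have hdisj : ∀ ρ : Finset α, ρ ⊆ (univ.map e)ᶜ → Disjoint ρ (τ.map e) := fun ρ hρ =>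
    disjoint_left.2 fun y hy hy' => mem_compl.1 (hρ hy) (map_subset_map.2 (subset_univ _) hy')
  refine card_le_card_of_injOn (fun ρ => ρ ∪ τ.map e) ?_ ?_
  · intro ρ hρ
    rw [mem_coe, mem_powersetCard] at hρ
    rw [mem_coe, mem_filter]
    refine ⟨mem_univ _, ?_, ?_⟩
    · rw [card_union_of_disjoint (hdisj ρ hρ.1), card_map, hρ.2]
      omega
    · ext x
      have : e x ∉ ρ := fun h => mem_compl.1 (hρ.1 h) (mem_map_of_mem _ (mem_univ _))
      simp [trace, this]
  · intro ρ hρ ρ' hρ' h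
    rw [mem_coe, mem_powersetCard] at hρ hρ'
    have h1 := union_sdiff_cancel_right (hdisj ρ hρ.1)
    have h2 := union_sdiff_cancel_right (hdisj ρ' hρ'.1)
    simp only at h
    rw [← h1, h, h2]

open Classical in
lemma sum_choose_le_card_tops (hp : t * N ≤ p) :
    ∑ τ ∈ univ.filter (IsTop (prodBlk t N) q t), (Fintype.card α - t * N).choose (p - #τ) ≤
      #(tops (embBlk e) q t p) := by
  have hle : ∀ τ : Finset (Fin t × Fin N), #τ ≤ p := fun τ => by
    have := τ.card_le_univ
    rw [Fintype.card_prod, Fintype.card_fin, Fintype.card_fin] at this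
    omega
  refine (sum_le_sum fun τ _ => choose_le_card_filter_trace e (hle τ)).trans ?_
  rw [← card_sigma]
  refine card_le_card_of_injOn (fun x => x.2) ?_ ?_
  · rintro ⟨τ, A⟩ h
    simp only [mem_coe, mem_sigma, mem_filter, mem_univ, true_and] at h
    obtain ⟨hτ, hA, rfl⟩ := h
    exact mem_coe.2 (mem_tops.2 ⟨hA, isTop_embBlk e hτ⟩)
  · rintro ⟨τ, A⟩ h ⟨τ', A'⟩ h' heq
    simp only [mem_coe, mem_sigma, mem_filter, mem_univ, true_and] at h h' heq
    obtain ⟨-, -, rfl⟩ := h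
    obtain ⟨-, -, rfl⟩ := h'
    rw [heq]

end Trace

/-! ### Limits of binomial ratios -/

section Asymptotics

lemma tendsto_div_sub_const {u : ℕ → ℝ} {C : ℝ} (c : ℝ) (hu : ∀ n, |u n - n / 2| ≤ C) :
    Tendsto (fun n : ℕ => u n / ((n : ℝ) - c)) atTop (𝓝 (1 / 2)) := by
  have hsub : Tendsto (fun n : ℕ => (n : ℝ) - c) atTop atTop :=
    tendsto_atTop_add_const_right _ _ tendsto_natCast_atTop_atTop
  have h0 : Tendsto (fun n : ℕ => (C + |c| / 2) / ((n : ℝ) - c)) atTop (𝓝 0) :=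
    tendsto_const_nhds.div_atTop hsub
  rw [tendsto_iff_norm_sub_tendsto_zero]
  refine squeeze_zero' (Eventually.of_forall fun n => norm_nonneg _) ?_ h0
  filter_upwards [hsub.eventually_gt_atTop 0] with n hn
  have h1 : u n / ((n : ℝ) - c) - 1 / 2 = (u n - n / 2 + c / 2) / ((n : ℝ) - c) := by
    field_simp
    ring
  rw [h1, Real.norm_eq_abs, abs_div, abs_of_pos hn]
  refine div_le_div_of_nonneg_right ((abs_add_le _ _).trans (add_le_add (hu n) ?_)) hn.le
  rw [abs_div, abs_two]

lemma abs_half_sub_le (n : ℕ) : |((n / 2 : ℕ) : ℝ) - n / 2| ≤ 1 := by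
  have h1 : 2 * ((n / 2 : ℕ) : ℝ) ≤ n := by exact_mod_cast Nat.mul_div_le n 2
  have h2 : (n : ℝ) ≤ 2 * ((n / 2 : ℕ) : ℝ) + 1 := by
    exact_mod_cast (by omega : n ≤ 2 * (n / 2) + 1)
  rw [abs_le]
  constructor <;> linarith

lemma choose_middle_pos (n : ℕ) : (0 : ℝ) < n.choose (n / 2) := by
  exact_mod_cast Nat.choose_pos (Nat.div_le_self n 2)

/-- Prescribing a middle-level set on c points costs a factor tending to 1/2 per point: each
induction step fixes one more point as in the set (j = c + 1) or out of it (j ≤ c). -/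
lemma tendsto_choose_sub_div_choose (c : ℕ) : ∀ j ≤ c,
    Tendsto (fun n : ℕ => ((n - c).choose (n / 2 - j) : ℝ) / n.choose (n / 2)) atTop
      (𝓝 ((1 / 2) ^ c)) := by
  induction c with
  | zero =>
    intro j hj
    obtain rfl : j = 0 := by omega
    simp [div_self (choose_middle_pos _).ne']
  | succ c ih =>
    intro j hj
    rcases Nat.lt_or_ge c j with h | h
    · obtain rfl : j = c + 1 := by omega
      have hratio : Tendsto (fun n : ℕ => (((n / 2 : ℕ) : ℝ) - c) / ((n : ℝ) - c)) atTop
          (𝓝 (1 / 2)) := by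
        refine tendsto_div_sub_const (C := 1 + c) c fun n => ?_
        have h1 := abs_le.1 (abs_half_sub_le n)
        have h2 : (0 : ℝ) ≤ c := Nat.cast_nonneg c
        rw [abs_le]
        constructor <;> linarith
      have := (ih c le_rfl).mul hratio
      rw [← pow_succ] at this
      refine this.congr' ?_
      filter_upwards [eventually_ge_atTop (2 * (c + 1))] with n hn
      have hid := Nat.add_one_mul_choose_eq (n - (c + 1)) (n / 2 - (c + 1))
      rw [show n - (c + 1) + 1 = n - c by omega,
        show n / 2 - (c + 1) + 1 = n / 2 - c by omega] at hid
      have hid' : ((n : ℝ) - c) * ((n - (c + 1)).choose (n / 2 - (c + 1)) : ℝ) =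
          ((n - c).choose (n / 2 - c) : ℝ) * (((n / 2 : ℕ) : ℝ) - c) := by
        rw [← Nat.cast_sub (show c ≤ n by omega), ← Nat.cast_sub (show c ≤ n / 2 by omega)]
        exact_mod_cast hid
      have hpos : (0 : ℝ) < (n : ℝ) - c := by
        rw [← Nat.cast_sub (show c ≤ n by omega)]
        exact_mod_cast (show 0 < n - c by omega)
      rw [div_mul_div_comm, ← hid', mul_comm (n.choose (n / 2) : ℝ), mul_div_mul_left _ _ hpos.ne']
    · have hratio : Tendsto (fun n : ℕ => ((n : ℝ) - c - (((n / 2 : ℕ) : ℝ) - j)) / ((n : ℝ) - c))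
          atTop (𝓝 (1 / 2)) := by
        refine tendsto_div_sub_const (C := 1 + c + j) c fun n => ?_
        have h1 := abs_le.1 (abs_half_sub_le n)
        have h2 : (0 : ℝ) ≤ c := Nat.cast_nonneg c
        have h3 : (0 : ℝ) ≤ j := Nat.cast_nonneg j
        rw [abs_le]
        constructor <;> linarith
      have := (ih j h).mul hratio
      rw [← pow_succ] at this
      refine this.congr' ?_
      filter_upwards [eventually_ge_atTop (2 * (c + 1))] with n hn
      have hid := Nat.choose_mul_succ_eq (n - (c + 1)) (n / 2 - j)
      rw [show n - (c + 1) + 1 = n - c by omega] at hid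
      have hid' : ((n : ℝ) - c) * ((n - (c + 1)).choose (n / 2 - j) : ℝ) =
          ((n - c).choose (n / 2 - j) : ℝ) * ((n : ℝ) - c - (((n / 2 : ℕ) : ℝ) - j)) := by
        rw [← Nat.cast_sub (show c ≤ n by omega), ← Nat.cast_sub (show j ≤ n / 2 by omega),
          ← Nat.cast_sub (show n / 2 - j ≤ n - c by omega), mul_comm]
        exact_mod_cast hid
      have hpos : (0 : ℝ) < (n : ℝ) - c := by
        rw [← Nat.cast_sub (show c ≤ n by omega)]
        exact_mod_cast (show 0 < n - c by omega)
      rw [div_mul_div_comm, ← hid', mul_comm (n.choose (n / 2) : ℝ), mul_div_mul_left _ _ hpos.ne']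

lemma tendsto_choose_middle_inv : Tendsto (fun n : ℕ => ((n.choose (n / 2) : ℝ))⁻¹) atTop (𝓝 0) := by
  refine tendsto_inv_atTop_zero.comp
    (tendsto_atTop_mono' _ ?_ tendsto_natCast_atTop_atTop)
  filter_upwards [eventually_ge_atTop 2] with n hn
  exact_mod_cast le_choose_of_pos_of_lt (show 0 < n / 2 by omega) (show n / 2 < n by omega)

end Asymptotics

/-! ### Asymptotics of `La` -/

section LaBounds
variable {n k l s : ℕ}

lemma numCopies_le_La {Ps : Set FinPartOrd.{0}} {Q : FinPartOrd.{0}} {F : Finset (Finset (Fin n))}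
    (hF : IsFree Ps F) : numCopies Q F ≤ La n Ps Q := by
  classical
  exact Finset.le_sup (f := fun F : Finset (Finset (Fin n)) => numCopies Q F)
    (mem_filter.2 ⟨mem_univ _, hF⟩)

lemma exists_numCopies_eq_La {Ps : Set FinPartOrd.{0}} {Q : FinPartOrd.{0}}
    (hne : ∃ F : Finset (Finset (Fin n)), IsFree Ps F) :
    ∃ F : Finset (Finset (Fin n)), IsFree Ps F ∧ numCopies Q F = La n Ps Q := by
  classical
  obtain ⟨F₀, hF₀⟩ := hne
  obtain ⟨F, hF, h⟩ := exists_mem_eq_sup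
    (univ.filter fun F : Finset (Finset (Fin n)) => IsFree Ps F)
    ⟨F₀, mem_filter.2 ⟨mem_univ _, hF₀⟩⟩ fun F => numCopies Q F
  exact ⟨F, (mem_filter.1 hF).2, h.symm⟩

lemma card_le_of_degree_le {H : Finset (Finset (Fin n))} {D : ℕ}
    (hD : ∀ A ∈ H, #(below H A) ≤ D ∧ #(above H A) ≤ D) (hn : 4 * D < n) :
    (#H : ℝ) ≤ 1 + n / ((n : ℝ) - 4 * D) * n.choose (n / 2) := by
  -- The chain bound needs the full set removed; this costs the summand 1.
  have hsub : H.erase univ ⊆ H := erase_subset _ _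
  have h := card_mul_card_le_of_degree_le (H := H.erase univ) (D := D) (notMem_erase _ _)
    fun A hA => ⟨(card_le_card (filter_subset_filter _ hsub)).trans (hD A (hsub hA)).1,
      (card_le_card (filter_subset_filter _ hsub)).trans (hD A (hsub hA)).2⟩
  rw [Fintype.card_fin] at h
  have h1 : #H ≤ #(H.erase univ) + 1 := by
    have := pred_card_le_card_erase (s := H) (a := univ)
    omega
  have hpos : (0 : ℝ) < (n : ℝ) - 4 * D := by
    rw [sub_pos]
    exact_mod_cast hn
  have h2 : (#(H.erase univ) : ℝ) ≤ n / ((n : ℝ) - 4 * D) * n.choose (n / 2) := by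
    rw [div_mul_eq_mul_div, le_div_iff₀ hpos]
    have : (n : ℝ) * #(H.erase univ) ≤ n * n.choose (n / 2) + 4 * D * #(H.erase univ) := by
      exact_mod_cast h
    linarith
  have h3 : (#H : ℝ) ≤ #(H.erase univ) + 1 := by exact_mod_cast h1
  linarith

lemma La_div_choose_le {K L : ℕ} (hs : 1 ≤ s) (hsK : s ≤ K) (h : s = K ∨ (K ≤ 4 ∧ L ≤ 4))
    (hn : 4 * (K + L + K * (L * L) + L * (K * K)) < n) :
    (La n {wedge (K + 1), vee (L + 1)} (wedge s) : ℝ) / n.choose (n / 2) ≤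
      K.choose s * ((L : ℝ) / (K + L)) * (((n.choose (n / 2) : ℝ))⁻¹ +
        n / ((n : ℝ) - 4 * (K + L + K * (L * L) + L * (K * K) : ℕ))) := by
  obtain ⟨F, hF, hLa⟩ := exists_numCopies_eq_La (n := n) (Ps := {wedge (K + 1), vee (L + 1)})
    (Q := wedge s) ⟨∅, isFree_wedge_vee_iff.2 (by simp)⟩
  rw [isFree_wedge_vee_iff] at hF
  obtain ⟨H, hH, hle⟩ := exists_sum_choose_below_le hs hsK h
    (fun A hA => Nat.lt_succ_iff.1 (hF A hA).1) (fun A hA => Nat.lt_succ_iff.1 (hF A hA).2)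
  rw [← numCopies_wedge, hLa] at hle
  have hcard := card_le_of_degree_le hH hn
  have hC := choose_middle_pos n
  have hKL : (0 : ℝ) < K + L := by
    exact_mod_cast (by omega : 0 < K + L)
  have hle' : ((K : ℝ) + L) * La n {wedge (K + 1), vee (L + 1)} (wedge s) ≤
      K.choose s * L * #H := by exact_mod_cast hle
  have h1 : (La n {wedge (K + 1), vee (L + 1)} (wedge s) : ℝ) ≤
      K.choose s * ((L : ℝ) / (K + L)) * #H := by
    rw [mul_div_assoc', div_mul_eq_mul_div, le_div_iff₀ hKL]
    linarith
  rw [div_le_iff₀ hC]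
  refine h1.trans ?_
  rw [mul_assoc (_ * _)]
  refine mul_le_mul_of_nonneg_left (hcard.trans_eq ?_) (by positivity)
  rw [add_mul, inv_mul_cancel₀ hC.ne']

open Classical in
lemma choose_mul_sum_le_La {q L t : ℕ} (htn : t * (q + L) + 1 ≤ n / 2) :
    (q + 1).choose s * ∑ τ ∈ univ.filter (IsTop (prodBlk t (q + L)) q t),
      (n - t * (q + L)).choose (n / 2 - #τ) ≤
      La n {wedge (q + 1 + 1), vee (L + 1)} (wedge s) := by
  obtain ⟨e⟩ : Nonempty (Fin t × Fin (q + L) ↪ Fin n) := by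
    rw [Function.Embedding.nonempty_iff_card_le, Fintype.card_prod, Fintype.card_fin,
      Fintype.card_fin, Fintype.card_fin]
    omega
  have hblk : ∀ i < t, #(univ.filter fun x => embBlk e x = i) = q + L :=
    fun i hi => card_filter_embBlk e hi
  have hfree : IsFree {wedge (q + 1 + 1), vee (L + 1)}
      (blockFamily (embBlk e) q t (n / 2 - 1)) :=
    isFree_wedge_vee_iff.2 fun A hA => by
      have := blockFamily_degree_le hblk hA
      omega
  refine le_trans ?_ (numCopies_le_La hfree)
  rw [numCopies_wedge]
  refine le_trans ?_ choose_mul_card_tops_le_sum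
  -- The level of the bottoms was chosen so that the tops lie in the middle level.
  rw [show n / 2 - 1 + 1 = n / 2 by omega]
  refine Nat.mul_le_mul_left _ ?_
  have := sum_choose_le_card_tops (q := q) (p := n / 2) e (by omega)
  rwa [Fintype.card_fin] at this

open Classical in
lemma eventually_lt_La_div_choose {q L : ℕ} (hL : 1 ≤ L) {a : ℝ}
    (ha : a < (q + 1).choose s * ((L : ℝ) / ((q + 1 : ℕ) + L))) :
    ∀ᶠ n : ℕ in atTop,
      a < (La n {wedge (q + 1 + 1), vee (L + 1)} (wedge s) : ℝ) / n.choose (n / 2) := by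
  set N := q + L with hN
  set T : ℕ → ℝ := fun t => #(univ.filter (IsTop (prodBlk t N) q t)) with hT
  have hKL : (0 : ℝ) < (q + 1 : ℕ) + L := by positivity
  have h2N : (1 : ℝ) ≤ 2 ^ N := one_le_pow₀ one_le_two
  -- the proportion of top sets among all subsets of the blocks
  have hprop : ∀ t, (L : ℝ) / ((q + 1 : ℕ) + L) * (1 - ((2 ^ N - 1) / 2 ^ N) ^ t) ≤
      T t * (1 / 2) ^ (t * N) := by
    intro t
    have h1 := mul_two_pow_le (blk := prodBlk t N) (q := q) (t := t) (L := L)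
      fun i hi => card_filter_prodBlk hi
    have h2 := card_badSets_le (t := t) (N := N) (q := q) (by omega)
    rw [Fintype.card_prod, Fintype.card_fin, Fintype.card_fin] at h1
    have h3 : (L : ℝ) * 2 ^ (t * N) ≤ ((q + 1 : ℕ) + L) * T t + L * (2 ^ N - 1) ^ t := by
      have h2' : (#(badSets (prodBlk t N) q t) : ℝ) ≤ (2 ^ N - 1) ^ t := by
        have : ((2 ^ N - 1 : ℕ) : ℝ) = 2 ^ N - 1 := by
          rw [Nat.cast_sub Nat.one_le_two_pow]
          simp
        rw [← this]
        exact_mod_cast h2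
      have h1' : (L : ℝ) * 2 ^ (t * N) ≤ ((q + 1 : ℕ) + L) * T t +
          L * #(badSets (prodBlk t N) q t) := by
        simp only [hT]
        exact_mod_cast h1
      have := mul_le_mul_of_nonneg_left h2' (Nat.cast_nonneg (α := ℝ) L)
      linarith
    have hpow : (0 : ℝ) < 2 ^ (t * N) := by positivity
    rw [div_mul_eq_mul_div, div_le_iff₀ hKL, div_pow (2 ^ N - 1 : ℝ), ← pow_mul, mul_comm N t,
      one_div, inv_pow]
    have h4 : (L : ℝ) * (1 - (2 ^ N - 1) ^ t / 2 ^ (t * N)) =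
        (L * 2 ^ (t * N) - L * (2 ^ N - 1) ^ t) * (2 ^ (t * N))⁻¹ := by
      field_simp
    rw [h4]
    have h5 : T t * (2 ^ (t * N))⁻¹ * ((q + 1 : ℕ) + L) =
        (((q + 1 : ℕ) + L) * T t) * (2 ^ (t * N))⁻¹ := by ring
    rw [h5]
    exact mul_le_mul_of_nonneg_right (by linarith) (by positivity)
  -- Order of limits: t is fixed first, making bad sets negligible, and only then does n tend to
  -- infinity.
  obtain ⟨t, ht⟩ : ∃ t, a < (q + 1).choose s * (T t * (1 / 2) ^ (t * N)) := by
    have hlim : Tendsto (fun t : ℕ => ((q + 1).choose s : ℝ) *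
        ((L : ℝ) / ((q + 1 : ℕ) + L) * (1 - ((2 ^ N - 1) / 2 ^ N) ^ t))) atTop
        (𝓝 ((q + 1).choose s * ((L : ℝ) / ((q + 1 : ℕ) + L) * (1 - 0)))) := by
      refine ((tendsto_const_nhds.sub (tendsto_pow_atTop_nhds_zero_of_lt_one ?_ ?_)).const_mul
        _).const_mul _
      · exact div_nonneg (by linarith) (by positivity)
      · rw [div_lt_one (by positivity)]
        linarith
    rw [sub_zero, mul_one] at hlim
    obtain ⟨t, ht⟩ := (hlim.eventually_const_lt ha).exists
    exact ⟨t, ht.trans_le (mul_le_mul_of_nonneg_left (hprop t) (Nat.cast_nonneg _))⟩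
  have hlim : Tendsto (fun n : ℕ => ((q + 1).choose s : ℝ) *
      ∑ τ ∈ univ.filter (IsTop (prodBlk t N) q t),
        ((n - t * N).choose (n / 2 - #τ) : ℝ) / n.choose (n / 2)) atTop
      (𝓝 ((q + 1).choose s * (T t * (1 / 2) ^ (t * N)))) := by
    have : T t * (1 / 2) ^ (t * N) =
        ∑ τ ∈ univ.filter (IsTop (prodBlk t N) q t), (1 / 2 : ℝ) ^ (t * N) := by
      rw [sum_const, nsmul_eq_mul]
    rw [this]
    refine (tendsto_finsetSum _ fun τ _ => tendsto_choose_sub_div_choose _ _ ?_).const_mul _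
    simpa using τ.card_le_univ
  filter_upwards [hlim.eventually_const_lt ht, eventually_ge_atTop (2 * (t * N + 1))] with n hn hn'
  refine hn.trans_le ?_
  rw [← sum_div, mul_div_assoc']
  refine div_le_div_of_nonneg_right ?_ (choose_middle_pos n).le
  have htn : t * (q + L) + 1 ≤ n / 2 := by
    rw [← hN]
    omega
  exact_mod_cast choose_mul_sum_le_La (n := n) (s := s) htn

lemma tendsto_La_div_choose {K L : ℕ} (hs : 1 ≤ s) (hsK : s ≤ K)
    (h : s = K ∨ (K ≤ 4 ∧ L ≤ 4)) :
    Tendsto (fun n : ℕ =>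
      (La n {wedge (K + 1), vee (L + 1)} (wedge s) : ℝ) / n.choose (n / 2)) atTop
      (𝓝 (K.choose s * ((L : ℝ) / (K + L)))) := by
  rw [tendsto_order]
  constructor
  · intro a ha
    rcases Nat.eq_zero_or_pos L with rfl | hL
    · refine Eventually.of_forall fun n => lt_of_lt_of_le ?_
        (div_nonneg (Nat.cast_nonneg _) (Nat.cast_nonneg _))
      simpa using ha
    · obtain ⟨q, rfl⟩ := Nat.exists_eq_add_of_le' (hs.trans hsK)
      exact eventually_lt_La_div_choose hL ha
  · intro a ha
    set D := K + L + K * (L * L) + L * (K * K) with hD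
    have h1 : Tendsto (fun n : ℕ => (n : ℝ) / ((n : ℝ) - 4 * (D : ℕ))) atTop (𝓝 1) := by
      -- Twice the limit 1/2 of (n/2)/(n - 4D).
      have := (tendsto_div_sub_const (u := fun n => (n : ℝ) / 2) (C := 0) (4 * (D : ℝ))
        fun n => by simp).const_mul 2
      norm_num at this
      refine this.congr fun n => ?_
      ring
    have h2 := (tendsto_choose_middle_inv.add h1).const_mul (K.choose s * ((L : ℝ) / (K + L)))
    rw [zero_add, mul_one] at h2
    filter_upwards [h2.eventually_lt_const ha, eventually_gt_atTop (4 * D)] with n hn hn'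
    exact (La_div_choose_le hs hsK h hn').trans_lt hn

end LaBounds

end ForbiddenSubposet

theorem theorem1p6 (k l s : ℕ) (hs : 1 ≤ s) (hsk : s ≤ k - 1) (hl : 1 ≤ l)
    (h : s = k - 1 ∨ (k ≤ 5 ∧ l ≤ 5)) :
    ∃ ε : ℕ → ℝ, Tendsto ε atTop (𝓝 0) ∧
      ∀ n : ℕ,
        (ForbiddenSubposet.La n {ForbiddenSubposet.wedge k, ForbiddenSubposet.vee l}
            (ForbiddenSubposet.wedge s) : ℝ) =
          (((k - 1).choose s : ℝ) * (((l : ℝ) - 1) / ((k : ℝ) + (l : ℝ) - 2)) + ε n) *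
            (n.choose (n / 2) : ℝ) := by
  obtain ⟨K, rfl⟩ := Nat.exists_eq_add_of_le' (show 1 ≤ k by omega)
  obtain ⟨L, rfl⟩ := Nat.exists_eq_add_of_le' hl
  rw [Nat.add_sub_cancel] at *
  have hlim := ForbiddenSubposet.tendsto_La_div_choose (L := L) hs hsk (by omega)
  have hconst : (((L + 1 : ℕ) : ℝ) - 1) / (((K + 1 : ℕ) : ℝ) + ((L + 1 : ℕ) : ℝ) - 2) =
      (L : ℝ) / (K + L) := by
    push_cast
    congr 1 <;> ring
  rw [hconst]
  refine ⟨_, by simpa using hlim.sub_const (K.choose s * ((L : ℝ) / (K + L))), fun n => ?_⟩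
  rw [add_sub_cancel, div_mul_cancel₀ _ (ForbiddenSubposet.choose_middle_pos n).ne']
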